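/- Let $\mathfrak S_n$ be the set of permutations $\pi=\pi_1\cdots\pi_n$ of $\{1,\dots,n\}$ and $\mathfrak S=\bigsqcup_{n\ge 0}\mathfrak S_n$. For a word $w$ with distinct letters, its standardization $\operatorname{std}(w)$ is the permutation obtained by replacing the smallest letter by $1$, the second smallest by $2$, and so on. For $\pi\in\mathfrak S_n$ let $\operatorname{Des}(\pi)=\{i: 1\le i\le n-1,\ \pi_i>\pi_{i+1}\}$, $\operatorname{des}(\pi)=|\operatorname{Des}(\pi)|$, $\operatorname{comaj}(\pi)=\sum_{i\in\operatorname{Des}(\pi)}(n-i)$, $\operatorname{ides}(\pi)=\operatorname{des}(\pi^{-1})$ and $\operatorname{icomaj}(\pi)=\operatorname{comaj}(\pi^{-1})$. Let $\Gamma\subseteq\mathfrak S$. An occurrence in $\pi\in\mathfrak S_n$ of a pattern from $\Gamma$ is a pair $(i,\sigma)$ with $\sigma\in\Gamma\cap\mathfrak S_m$ for some $m$, $1\le i\le n-m+1$ and $\operatorname{std}(\pi_i\pi_{i+1}\cdots\pi_{i+m-1})=\sigma$; let $\operatorname{occ}_\Gamma(\pi)$ be the number of occurrences. A marked permutation is a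 pair $(\pi,T)$ where $T$ is a set of occurrences in $\pi$ of patterns from $\Gamma$. It is a concatenation of marked permutations $(\alpha,T_1)$ and $(\beta,T_2)$ of lengths $a$ and $b$ if $\pi$ has length $a+b$, $\operatorname{std}(\pi_1\cdots\pi_a)=\alpha$, $\operatorname{std}(\pi_{a+1}\cdots\pi_{a+b})=\beta$ and $T=T_1\cup\{(i+a,\sigma):(i,\sigma)\in T_2\}$. A $\Gamma$-cluster is a marked permutation that is not a concatenation of two nonempty (that is, of positive length) marked permutations. Let $C_{\Gamma,\pi}$ be the set of $\Gamma$-clusters $c=(\pi,T)$ on $\pi$, and let $\operatorname{mk}_\Gamma(c)=|T|$. Define $$A_{\Gamma,n}^{(\mathrm{ides},\mathrm{icomaj})}(s,t,q)=\sum_{\pi\in\mathfrak S_n}s^{\operatorname{occ}_\Gamma(\pi)}t^{\operatorname{ides}(\pi)+1}q^{\operatorname{icomaj}(\pi)}\quad(n\ge1),\qquad A_{\Gamma,0}^{(\mathrm{ides},\mathrm{icomaj})}(s,t,q)=1,$$ $$R_{\Gamma,k}^{(\mathrm{ides},\mathrm{icomaj})}(s,t,q)=\sum_{\pi\in\mathfrak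 S_k}t^{\operatorname{ides}(\pi)+1}q^{\operatorname{icomaj}(\pi)}\sum_{c\in C_{\Gamma,\pi}}s^{\operatorname{mk}_\Gamma(c)}.$$ In $\mathbb Q[[s,t,q,x]]$, regarded as the formal power series in $t$ over $\mathbb Q[[s,q,x]]$, the Hadamard product in $t$ is $\big(\sum_k a_kt^k\big)*\big(\sum_k b_kt^k\big)=\sum_k a_kb_kt^k$. Write $f^{*\langle n\rangle}$ for the $n$-fold Hadamard product of $f$, with $f^{*\langle 0\rangle}=1/(1-t)$, the identity of $*$. **Theorem.** Let $\Gamma\subseteq\mathfrak S$ be a set of permutations, each of length at least $2$. Then, in $\mathbb Q[[s,t,q,x]]$, $$\sum_{n=0}^{\infty}\frac{A_{\Gamma,n}^{(\mathrm{ides},\mathrm{icomaj})}(s,t,q)}{\prod_{i=0}^{n}(1-tq^{i})}\,x^{n}=\sum_{n=0}^{\infty}\left(\frac{tx}{(1-t)(1-tq)}+\sum_{k=2}^{\infty}R_{\Gamma,k}^{(\mathrm{ides},\mathrm{icomaj})}(s-1,t,q)\frac{x^{k}}{\prod_{i=0}^{k}(1-tq^{i})}\right)^{*\langle n\rangle}.$$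 All three infinite sums are well defined as formal sums: each monomial has a nonzero coefficient in only finitely many summands. -/

import Mathlib

open Finset

noncomputable section

namespace PermCluster

/-! Permutations of length `n` are modelled by `Equiv.Perm (Fin n)`; positions and letters are
counted from `0`, so that `π i` is the letter `π_{i+1}` (diminished by one). -/

/-- The disjoint union of all symmetric groups. -/
abbrev AllPerms : Type := Σ m : ℕ, Equiv.Perm (Fin m)

/-- Descent set: the (one-based) positions `i ∈ [n-1]` with `π_i > π_{i+1}`. -/
def desSet {n : ℕ} (π : Equiv.Perm (Fin n)) : Finset ℕ :=
  {i ∈ Finset.Ico 1 n | ∃ a b : Fin n, (a : ℕ) + 1 = i ∧ (b : ℕ) = i ∧ π b < π a}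

/-- Descent number. -/
def des {n : ℕ} (π : Equiv.Perm (Fin n)) : ℕ := (desSet π).card

/-- Comajor index. The subtraction never truncates, as `i < n` for every descent `i`. -/
def comaj {n : ℕ} (π : Equiv.Perm (Fin n)) : ℕ := ∑ i ∈ desSet π, (n - i)

/-- Inverse descent number. -/
def ides {n : ℕ} (π : Equiv.Perm (Fin n)) : ℕ := des π⁻¹

/-- Inverse comajor index. -/
def icomaj {n : ℕ} (π : Equiv.Perm (Fin n)) : ℕ := comaj π⁻¹

/-- Standardization of a word with distinct letters: its smallest letter is replaced by `0`,
the second smallest by `1`, and so on. -/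
def std {m n : ℕ} (w : Fin m → Fin n) : Fin m → ℕ :=
  fun i => (univ.filter fun j : Fin m => w j < w i).card

/-- The consecutive letters of `π` in the positions `p, p + 1, …, p + m - 1`. -/
def window {n : ℕ} (π : Equiv.Perm (Fin n)) (p m : ℕ) (h : p + m ≤ n) : Fin m → Fin n :=
  fun j => π ⟨p + j, by have := j.isLt; omega⟩

/-- The consecutive letters of `π` in the positions `p, …, p + m - 1` standardize to `σ`. -/
def MatchesAt {n m : ℕ} (π : Equiv.Perm (Fin n)) (p : ℕ) (σ : Equiv.Perm (Fin m)) : Prop :=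
  ∃ h : p + m ≤ n, std (window π p m h) = fun i => (σ i : ℕ)

/-- The set of all `(p, σ)` with `σ ∈ Γ` such that `σ` occurs, as a consecutive pattern, in `π`
starting at position `p`. -/
def occSet (Γ : Set AllPerms) {n : ℕ} (π : Equiv.Perm (Fin n)) : Set (ℕ × AllPerms) :=
  {o | o.2 ∈ Γ ∧ MatchesAt π o.1 o.2.2}

theorem occSet_finite (Γ : Set AllPerms) {n : ℕ} (π : Equiv.Perm (Fin n)) :
    (occSet Γ π).Finite := by
  refine Set.Finite.subset (s := ((Finset.range (n + 1)) ×ˢ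
    ((Finset.range (n + 1)).sigma fun m => (univ : Finset (Equiv.Perm (Fin m)))) :
      Finset (ℕ × AllPerms))) (Finset.finite_toSet _) ?_
  rintro ⟨p, m, σ⟩ ⟨_, h, _⟩
  have h' : p + m ≤ n := h
  have h1 : p < n + 1 := by omega
  have h2 : m < n + 1 := by omega
  simp [h1, h2]

/-- The finite set of occurrences in `π` of patterns in `Γ`. -/
def occurrences (Γ : Set AllPerms) {n : ℕ} (π : Equiv.Perm (Fin n)) : Finset (ℕ × AllPerms) :=
  (occSet_finite Γ π).toFinset

/-- The number of occurrences in `π` of patterns in `Γ`. -/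
def occ (Γ : Set AllPerms) {n : ℕ} (π : Equiv.Perm (Fin n)) : ℕ := (occurrences Γ π).card

/-- `(π, T)` is a marked permutation with respect to `Γ`: `T` is a set of occurrences in `π` of
patterns in `Γ`. -/
def IsMarked (Γ : Set AllPerms) {n : ℕ} (π : Equiv.Perm (Fin n)) (T : Finset (ℕ × AllPerms)) :
    Prop :=
  T ⊆ occurrences Γ π

/-- `(π, T)` is a concatenation of `(α, T₁)` and `(β, T₂)`: the first `a` letters of `π`
standardize to `α`, the remaining `b` letters standardize to `β`, and the marks of `π` are those
of `α` together with those of `β` shifted by `a`. -/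
def IsConcat {n a b : ℕ} (π : Equiv.Perm (Fin n)) (T : Finset (ℕ × AllPerms))
    (α : Equiv.Perm (Fin a)) (T₁ : Finset (ℕ × AllPerms))
    (β : Equiv.Perm (Fin b)) (T₂ : Finset (ℕ × AllPerms)) : Prop :=
  a + b = n ∧ MatchesAt π 0 α ∧ MatchesAt π a β ∧
    T = T₁ ∪ T₂.image fun o => (a + o.1, o.2)

/-- `(π, T)` is a `Γ`-cluster: a marked permutation that is not a concatenation of two nonempty
marked permutations. -/
def IsCluster (Γ : Set AllPerms) {n : ℕ} (π : Equiv.Perm (Fin n)) (T : Finset (ℕ × AllPerms)) :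
    Prop :=
  IsMarked Γ π T ∧
    ¬ ∃ (a b : ℕ) (α : Equiv.Perm (Fin a)) (β : Equiv.Perm (Fin b))
        (T₁ T₂ : Finset (ℕ × AllPerms)),
      0 < a ∧ 0 < b ∧ IsMarked Γ α T₁ ∧ IsMarked Γ β T₂ ∧ IsConcat π T α T₁ β T₂

open Classical in
/-- The set of all `Γ`-clusters on `π`, each given by its set of marked occurrences. -/
def clusters (Γ : Set AllPerms) {n : ℕ} (π : Equiv.Perm (Fin n)) :
    Finset (Finset (ℕ × AllPerms)) :=
  {T ∈ (occurrences Γ π).powerset | IsCluster Γ π T}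

/-- The polynomial `A_{Γ,n}(s,t,q) = ∑_π s^{occ π} t^{ides π + 1} q^{icomaj π}` (and `1` for
`n = 0`), evaluated at elements of a commutative ring. -/
def polyA {K : Type*} [CommRing K] (Γ : Set AllPerms) (n : ℕ) (s t q : K) : K :=
  if n = 0 then 1
  else ∑ π : Equiv.Perm (Fin n), s ^ occ Γ π * t ^ (ides π + 1) * q ^ icomaj π

/-- The cluster polynomial
`R_{Γ,k}(s,t,q) = ∑_π t^{ides π + 1} q^{icomaj π} ∑_{c cluster on π} s^{mk c}`, evaluated at
elements of a commutative ring. -/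
def polyR {K : Type*} [CommRing K] (Γ : Set AllPerms) (k : ℕ) (s t q : K) : K :=
  ∑ π : Equiv.Perm (Fin k), t ^ (ides π + 1) * q ^ icomaj π * ∑ c ∈ clusters Γ π, s ^ c.card

/-! The algebra `ℚ[[s,t,q,x]]`, as formal power series in `t` over `ℚ[[s,q,x]]`. -/

/-- The algebra `ℚ[[s,q,x]]`, with variables `s`, `q`, `x` numbered `0`, `1`, `2`. -/
abbrev SeriesSQX : Type := MvPowerSeries (Fin 3) ℚ

/-- The algebra `ℚ[[s,t,q,x]]`. -/
abbrev Series : Type := PowerSeries SeriesSQX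

/-- The variable `s`. -/
def varS : Series := PowerSeries.C (MvPowerSeries.X 0)

/-- The variable `t`. -/
def varT : Series := PowerSeries.X

/-- The variable `q`. -/
def varQ : Series := PowerSeries.C (MvPowerSeries.X 1)

/-- The variable `x`. -/
def varX : Series := PowerSeries.C (MvPowerSeries.X 2)

/-- The reciprocal `1 / f` of a series `f` whose coefficient of `t ^ 0` is `1`. -/
def recip (f : Series) : Series := PowerSeries.invOfUnit f 1

theorem mul_recip (f : Series) (h : PowerSeries.constantCoeff f = 1) : f * recip f = 1 :=
  PowerSeries.mul_invOfUnit f 1 (by simpa using h)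

/-- The product `∏_{i=0}^n (1 - t q^i)`. -/
def qProd (n : ℕ) : Series := ∏ i ∈ Finset.range (n + 1), (1 - varT * varQ ^ i)

theorem constantCoeff_qProd (n : ℕ) : PowerSeries.constantCoeff (qProd n) = 1 := by
  simp [qProd, varT, map_prod]

/-- Hadamard product in `t`. -/
def hadamard (f g : Series) : Series :=
  PowerSeries.mk fun k => PowerSeries.coeff k f * PowerSeries.coeff k g

/-- The `n`-fold Hadamard product of `f`; for `n = 0` it is the identity `1 / (1 - t)` of the
Hadamard product. -/
def hadamardPow (f : Series) : ℕ → Series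
  | 0 => recip (1 - varT)
  | n + 1 => hadamard (hadamardPow f n) f

/-- The coefficient of `t ^ k` times the monomial in `s, q, x` with exponents `d`. -/
def coeffAt (k : ℕ) (d : Fin 3 →₀ ℕ) (f : Series) : ℚ :=
  MvPowerSeries.coeff d (PowerSeries.coeff k f)

/-- The formal sum `∑_{n ≥ 0} f n` makes sense: each monomial has a nonzero coefficient in only
finitely many of the `f n`. -/
def FormallySummable (f : ℕ → Series) : Prop :=
  ∀ (k : ℕ) (d : Fin 3 →₀ ℕ), {n | coeffAt k d (f n) ≠ 0}.Finite

/-- The formal sum `∑_{n ≥ 0} f n`, taken coefficient by coefficient (meaningful for formally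
summable `f`). -/
def formalSum (f : ℕ → Series) : Series :=
  PowerSeries.mk fun k => (fun d => ∑ᶠ n, coeffAt k d (f n) : (Fin 3 →₀ ℕ) → ℚ)

end PermCluster

end

open PermCluster

/-!
The coefficient of `t ^ k` turns the identity into the cluster method for words over the alphabet
`{0, …, k - 1}`.

Standardize a word by ranking equal letters from left to right (`stdPerm`). The words with
standardization `π` correspond to the weakly increasing words `w ∘ π⁻¹` that increase strictly at
the descents of `π⁻¹`. Building these up letter by letter gives their enumeration by letter sum
and alphabet size, `t ^ (ides π + 1) q ^ icomaj π / ∏_{i=0}^n (1 - t q ^ i)`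
(`mk_sum_words_stdPerm`). Hence, after division by the product, the coefficient of `t ^ k` in the
`n`-th summand on the left is a sum over the words of length `n`, where `s ^ occ` expands as a sum
over all markings with weight `s - 1` per mark (`markedSum`); likewise `R` becomes a sum over
clusters on words (`clusterSum`), a single letter being the cluster of length `1`. The Hadamard
product is the ordinary product of coefficients of `t ^ k`.

Standardization commutes with passing to factors, so a marked word can be cut at every boundary
that no mark straddles, and it is a cluster when there is no such inner boundary
(`isCluster_stdPerm_iff`). Cutting at the first possible place splits off the first cluster and
gives the renewal equation `markedSum_succ`. With `F` and `G` the generating functions in `x` of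
marked words and of clusters, it reads `F = 1 + G F`, so that `F = ∑ G ^ n`. All formal sums are
controlled by the powers of `x`: two series agree if they agree modulo every power of `x`.
-/

open Finset

namespace PermCluster

/-! ### Words with a given standardization -/

/-- The words of length `n` over the alphabet `{0, …, k - 1}`. -/
def words (n k : ℕ) : Finset (Fin n → ℕ) := Fintype.piFinset fun _ => range k

theorem mem_words {n k : ℕ} {w : Fin n → ℕ} : w ∈ words n k ↔ ∀ i, w i < k := by
  simp [words]

/-- The standardization of a word with possibly repeated letters, where equal letters are ranked
from left to right: the inverse of the permutation that sorts the word stably. -/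
def stdPerm {n : ℕ} (w : Fin n → ℕ) : Equiv.Perm (Fin n) := (Tuple.sort w)⁻¹

/-- The word `v` is weakly increasing, and strictly so from (zero-based) position `j - 1` to `j`
whenever `j ∈ D`. -/
def IsAscending (D : Finset ℕ) {n : ℕ} (v : Fin n → ℕ) : Prop :=
  ∀ i j : Fin n, (i : ℕ) + 1 = j → v i + (if (j : ℕ) ∈ D then 1 else 0) ≤ v j

theorem IsAscending.monotone {D : Finset ℕ} {n : ℕ} {v : Fin n → ℕ} (h : IsAscending D v) :
    Monotone v := by
  cases n with
  | zero => exact fun i => i.elim0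
  | succ m =>
    refine Fin.monotone_iff_le_succ.2 fun i => ?_
    have := h i.castSucc i.succ (by simp)
    omega

theorem succ_mem_desSet {m : ℕ} (σ : Equiv.Perm (Fin (m + 1))) (i : Fin m) :
    (i : ℕ) + 1 ∈ desSet σ ↔ σ i.succ < σ i.castSucc := by
  simp only [desSet, mem_filter, mem_Ico]
  constructor
  · rintro ⟨-, a, b, ha, hb, hab⟩
    have h1 : a = i.castSucc := Fin.ext (by simpa using ha)
    have h2 : b = i.succ := Fin.ext (by simpa using hb)
    rwa [← h1, ← h2]
  · intro h
    exact ⟨⟨by omega, by omega⟩, i.castSucc, i.succ, by simp, by simp, h⟩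

/-- The words sorted by `σ` are the `P`-partitions of the chain labelled by `σ`. -/
theorem sort_eq_iff_isAscending {n : ℕ} (σ : Equiv.Perm (Fin n)) (w : Fin n → ℕ) :
    Tuple.sort w = σ ↔ IsAscending (desSet σ) (w ∘ σ) := by
  rw [eq_comm, Tuple.eq_sort_iff]
  cases n with
  | zero => exact ⟨fun _ i => i.elim0, fun _ => ⟨fun i => i.elim0, fun i => i.elim0⟩⟩
  | succ m =>
    constructor
    · rintro ⟨hm, ht⟩ i j hij
      obtain ⟨l, rfl⟩ : ∃ l : Fin m, l.castSucc = i := ⟨⟨i, by omega⟩, rfl⟩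
      obtain rfl : j = l.succ := Fin.ext (by simpa using hij.symm)
      have hle := hm (Fin.castSucc_lt_succ (i := l)).le
      have hd := succ_mem_desSet σ l
      rw [Fin.val_succ]
      split_ifs with h
      · have h1 := hd.1 h
        have h2 : w (σ l.castSucc) ≠ w (σ l.succ) := fun he =>
          (ht _ _ Fin.castSucc_lt_succ he).not_gt h1
        exact Nat.lt_of_le_of_ne hle h2
      · exact hle
    · intro h
      have hlex : StrictMono fun i => toLex (w (σ i), σ i) := by
        refine Fin.strictMono_iff_lt_succ.2 fun l => ?_
        rw [Prod.Lex.toLex_lt_toLex]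
        have h1 := h l.castSucc l.succ (by simp)
        have hd := succ_mem_desSet σ l
        rw [Fin.val_succ] at h1
        simp only [Function.comp] at h1
        split_ifs at h1 with h2
        · left; simp only; omega
        · rcases Nat.lt_or_eq_of_le (show w (σ l.castSucc) ≤ w (σ l.succ) by omega) with h3 | h3
          · exact Or.inl h3
          · refine Or.inr ⟨h3, ?_⟩
            rcases lt_trichotomy (σ l.castSucc) (σ l.succ) with h4 | h4 | h4
            · exact h4
            · exact absurd (σ.injective h4) Fin.castSucc_lt_succ.ne
            · exact absurd (hd.2 h4) h2
      refine ⟨h.monotone, fun i j hij he => ?_⟩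
      have := hlex hij
      rw [Prod.Lex.toLex_lt_toLex] at this
      rcases this with h1 | h1
      · exact absurd he h1.ne
      · exact h1.2

section AscSum

variable {K : Type*} [CommRing K]

open Classical in
/-- The generating function by letter sum of the words of length `n` with letters below `k` that
are ascending with respect to `D`. -/
noncomputable def ascSum (D : Finset ℕ) (q : K) (n k : ℕ) : K :=
  ∑ v ∈ words n k with IsAscending D v, q ^ ∑ i, v i

theorem ascSum_zero (D : Finset ℕ) (q : K) (k : ℕ) : ascSum D q 0 k = 1 := by
  classical
  have h : ∀ v ∈ words 0 k, IsAscending D v := fun _ _ i => i.elim0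
  rw [ascSum, filter_true_of_mem h]
  simp [words]

theorem isAscending_snoc {D : Finset ℕ} {n l : ℕ} {v : Fin n → ℕ} :
    IsAscending D (Fin.snoc v l : Fin (n + 1) → ℕ) ↔
      IsAscending D v ∧ ∀ i, v i < l + if n ∈ D then 0 else 1 := by
  constructor
  · intro h
    refine ⟨fun i j hij => ?_, fun i => ?_⟩
    · simpa using h i.castSucc j.castSucc (by simpa using hij)
    · have hn : 0 < n := by have := i.isLt; omega
      have h0 := h (Fin.castSucc ⟨n - 1, by omega⟩) (Fin.last n)
        (by simp only [Fin.val_castSucc, Fin.val_last]; omega)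
      have h1 : v i ≤ v ⟨n - 1, by omega⟩ := by
        have := h.monotone (a := i.castSucc) (b := Fin.castSucc ⟨n - 1, by omega⟩)
          (by rw [Fin.le_def]; simp only [Fin.val_castSucc]; omega)
        rwa [Fin.snoc_castSucc, Fin.snoc_castSucc] at this
      simp only [Fin.snoc_castSucc, Fin.snoc_last, Fin.val_last] at h0
      split_ifs at h0 ⊢ <;> omega
  · rintro ⟨h, hl⟩ i j hij
    obtain ⟨i, rfl⟩ : ∃ i' : Fin n, i'.castSucc = i := ⟨⟨i, by omega⟩, rfl⟩
    rcases Fin.eq_castSucc_or_eq_last j with ⟨j, rfl⟩ | rfl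
    · simpa using h i j (by simpa using hij)
    · have := hl i
      simp only [Fin.snoc_castSucc, Fin.snoc_last, Fin.val_last]
      split_ifs at this ⊢ <;> omega

/-- Recursion on the last letter `l`: the other letters are at most `l`, and less than `l` if
`n ∈ D`. For `n = 0` both alphabets give the same value. -/
theorem ascSum_succ (D : Finset ℕ) (q : K) (n k : ℕ) :
    ascSum D q (n + 1) k =
      ∑ l ∈ range k, q ^ l * ascSum D q n (l + if n ∈ D then 0 else 1) := by
  classical
  simp only [ascSum, mul_sum]
  rw [sum_sigma']
  refine sum_bij' (fun v _ => (⟨v (Fin.last n), Fin.init v⟩ : Σ _ : ℕ, Fin n → ℕ))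
    (fun x _ => (Fin.snoc x.2 x.1 : Fin (n + 1) → ℕ)) ?_ ?_ ?_ ?_ ?_
  · intro v hv
    obtain ⟨h1, h2⟩ := mem_filter.1 hv
    rw [mem_words] at h1
    rw [← Fin.snoc_init_self v, isAscending_snoc] at h2
    simp only [mem_sigma, mem_range, mem_filter, mem_words]
    exact ⟨h1 _, h2.2, h2.1⟩
  · rintro ⟨l, v⟩ hx
    simp only [mem_sigma, mem_range, mem_filter, mem_words] at hx ⊢
    refine ⟨fun i => ?_, isAscending_snoc.2 ⟨hx.2.2, hx.2.1⟩⟩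
    rcases Fin.eq_castSucc_or_eq_last i with ⟨i, rfl⟩ | rfl
    · have := hx.2.1 i
      simp only [Fin.snoc_castSucc]
      split_ifs at this <;> omega
    · simpa using hx.1
  · intro v _
    exact Fin.snoc_init_self v
  · rintro ⟨l, v⟩ _
    simp
  · intro v _
    rw [Fin.sum_univ_castSucc, add_comm, pow_add]
    rfl

/-- The generating series of `k ↦ ∑_{l < k} q ^ l g(l)` is `t / (1 - t)` times that of `g` at
`t q`. -/
theorem one_sub_X_mul_mk_sum (q : K) (g : ℕ → K) :
    (1 - PowerSeries.X) * PowerSeries.mk (fun k => ∑ l ∈ range k, q ^ l * g l) =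
      PowerSeries.X * PowerSeries.rescale q (PowerSeries.mk g) := by
  ext k
  rw [sub_mul, one_mul, map_sub]
  cases k with
  | zero => simp
  | succ k => simp [PowerSeries.coeff_succ_X_mul, sum_range_succ, PowerSeries.coeff_rescale]

theorem rescale_C (q c : K) : PowerSeries.rescale q (PowerSeries.C c) = PowerSeries.C c := by
  ext n
  simp only [PowerSeries.coeff_rescale, PowerSeries.coeff_C]
  split_ifs with h <;> simp [h]

/-- The product `∏_{i=0}^n (1 - t q ^ i)` over an arbitrary ring. -/
noncomputable def qProdSeries (q : K) (n : ℕ) : PowerSeries K :=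
  ∏ i ∈ range (n + 1), (1 - PowerSeries.X * PowerSeries.C q ^ i)

theorem qProdSeries_succ (q : K) (n : ℕ) :
    qProdSeries q (n + 1) = (1 - PowerSeries.X) * PowerSeries.rescale q (qProdSeries q n) := by
  rw [qProdSeries, prod_range_succ', qProdSeries, map_prod, mul_comm]
  congr 1
  · simp
  · refine prod_congr rfl fun i _ => ?_
    rw [map_sub, map_one, map_mul, map_pow, rescale_C, PowerSeries.rescale_X]
    ring

/-- The generating series in `t` of `k ↦ ascSum D q (n + 1) k`. By the recursion, one more letter
replaces `t` by `t q` and divides by `1 - t`, with an additional factor `t` when the step is strict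
and `q⁻¹` when it is weak. -/
theorem mk_ascSum_mul_qProdSeries [IsDomain K] (D : Finset ℕ) (q : K) (hq : q ≠ 0) (n : ℕ) :
    PowerSeries.mk (ascSum D q (n + 1)) * qProdSeries q (n + 1) =
      PowerSeries.X ^ (#(D ∩ Ico 1 (n + 1)) + 1) *
        PowerSeries.C q ^ ∑ i ∈ D ∩ Ico 1 (n + 1), (n + 1 - i) := by
  induction n with
  | zero =>
    have h1 : ascSum D q 1 = fun k => ∑ l ∈ range k, q ^ l * (fun _ => (1 : K)) l := by
      funext k; rw [ascSum_succ]; simp [ascSum_zero]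
    have h2 := PowerSeries.mk_one_mul_one_sub_eq_one K
    rw [h1, qProdSeries_succ, ← mul_assoc, mul_comm (PowerSeries.mk _), one_sub_X_mul_mk_sum,
      mul_assoc, ← map_mul]
    have h3 : PowerSeries.mk (fun _ => (1 : K)) * qProdSeries q 0 = 1 := by
      simpa [qProdSeries, Pi.one_def] using h2
    rw [h3]
    simp
  | succ n ih =>
    have hI : Ico 1 (n + 1 + 1) = insert (n + 1) (Ico 1 (n + 1)) := by
      ext i; simp only [mem_Ico, mem_insert]; omega
    have hsum : ∑ i ∈ D ∩ Ico 1 (n + 1), (n + 1 + 1 - i) =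
        ∑ i ∈ D ∩ Ico 1 (n + 1), (n + 1 - i) + #(D ∩ Ico 1 (n + 1)) := by
      rw [card_eq_sum_ones, ← sum_add_distrib]
      refine sum_congr rfl fun i hi => ?_
      have := mem_Ico.1 (mem_inter.1 hi).2
      omega
    have hnm : n + 1 ∉ D ∩ Ico 1 (n + 1) := by simp
    have ih' := congrArg (PowerSeries.rescale q) ih
    simp only [map_mul, map_pow, rescale_C, PowerSeries.rescale_X] at ih'
    by_cases hD : n + 1 ∈ D
    · have h1 : ascSum D q (n + 1 + 1) = fun k => ∑ l ∈ range k, q ^ l * ascSum D q (n + 1) l := by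
        funext k; rw [ascSum_succ]; simp [hD]
      rw [qProdSeries_succ, ← mul_assoc, mul_comm (PowerSeries.mk _), h1, one_sub_X_mul_mk_sum,
        mul_assoc, ih', hI, inter_insert_of_mem hD, sum_insert hnm, card_insert_of_notMem hnm, hsum]
      simp only [Nat.add_sub_cancel_left]
      ring
    · have h1 : ascSum D q (n + 1 + 1) =
          fun k => ∑ l ∈ range k, q ^ l * (fun m => ascSum D q (n + 1) (m + 1)) l := by
        funext k; rw [ascSum_succ]; simp [hD]
      -- the shifted series differs from the original one by a factor `t`, as no nonempty word
      -- has its letters in the empty alphabet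
      have h2 : PowerSeries.X * PowerSeries.mk (fun m => ascSum D q (n + 1) (m + 1)) =
          PowerSeries.mk (ascSum D q (n + 1)) := by
        ext k
        cases k with
        | zero => simp [ascSum_succ]
        | succ k => simp [PowerSeries.coeff_succ_X_mul]
      have h3 := congrArg (PowerSeries.rescale q) h2
      rw [map_mul, PowerSeries.rescale_X] at h3
      have hq' : (PowerSeries.C q : PowerSeries K) ≠ 0 := by
        simpa using (map_ne_zero_iff _ PowerSeries.C_injective).2 hq
      -- multiplying by `q` avoids the factor `q⁻¹` of a weak step
      refine mul_left_cancel₀ hq' ?_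
      rw [qProdSeries_succ, ← mul_assoc (PowerSeries.mk _), mul_comm (PowerSeries.mk _), h1,
        one_sub_X_mul_mk_sum, ← mul_assoc, ← mul_assoc, h3, ih', hI, inter_insert_of_notMem hD,
        hsum]
      ring

end AscSum

/-- The coefficient extraction behind the theorem: the words of length `n` with a given
standardization `π` are enumerated, by letter sum and by alphabet size, by
`t ^ (ides π + 1) q ^ icomaj π / ∏_{i=0}^n (1 - t q ^ i)`. -/
theorem mk_sum_words_stdPerm {K : Type*} [CommRing K] [IsDomain K] (q : K) (hq : q ≠ 0) {n : ℕ}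
    (hn : n ≠ 0) (π : Equiv.Perm (Fin n)) :
    PowerSeries.mk (fun k => ∑ w ∈ words n k with stdPerm w = π, q ^ ∑ i, w i) *
        qProdSeries q n =
      PowerSeries.X ^ (ides π + 1) * PowerSeries.C q ^ icomaj π := by
  classical
  obtain ⟨m, rfl⟩ := Nat.exists_eq_succ_of_ne_zero hn
  have hD : desSet π⁻¹ ∩ Ico 1 (m + 1) = desSet π⁻¹ :=
    inter_eq_left.2 (filter_subset _ _)
  have key := mk_ascSum_mul_qProdSeries (desSet π⁻¹) q hq m
  rw [hD] at key
  refine Eq.trans ?_ key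
  congr 2
  funext k
  rw [ascSum]
  have hv : ∀ w : Fin (m + 1) → ℕ, stdPerm w = π ↔ IsAscending (desSet π⁻¹) (w ∘ ⇑π⁻¹) := by
    intro w
    rw [← sort_eq_iff_isAscending, stdPerm, inv_eq_iff_eq_inv]
  refine sum_bij' (fun w _ => w ∘ ⇑π⁻¹) (fun v _ => v ∘ ⇑π) ?_ ?_ ?_ ?_ ?_
  · intro w hw
    rw [mem_filter, mem_words, hv] at hw
    rw [mem_filter, mem_words]
    exact ⟨fun i => hw.1 _, hw.2⟩
  · intro v h
    rw [mem_filter, mem_words] at h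
    rw [mem_filter, mem_words, hv]
    refine ⟨fun i => h.1 _, ?_⟩
    have : (v ∘ ⇑π) ∘ ⇑π⁻¹ = v := by ext; simp
    rw [this]
    exact h.2
  · intro w _; ext; simp
  · intro w _; ext; simp
  · intro w _
    congr 1
    exact (Equiv.sum_comp π⁻¹ w).symm

/-! ### Consecutive occurrences in words -/

theorem std_lt_std_iff {m n : ℕ} {w : Fin m → Fin n} {i j : Fin m} :
    std w i < std w j ↔ w i < w j := by
  have mono : ∀ {a b : Fin m}, w a ≤ w b → std w a ≤ std w b := fun h =>
    card_le_card fun l hl => by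
      simp only [mem_filter, mem_univ, true_and] at hl ⊢
      exact hl.trans_le h
  constructor
  · intro h
    by_contra hle
    exact absurd (mono (not_lt.1 hle)) (not_le.2 h)
  · intro h
    refine card_lt_card ?_
    rw [ssubset_iff_of_subset fun l hl => by
      simp only [mem_filter, mem_univ, true_and] at hl ⊢
      exact hl.trans h]
    exact ⟨i, by simpa using h, by simp⟩

/-- A window of `π` standardizes to `σ` if and only if it is ordered like `σ`. -/
theorem matchesAt_iff {n m : ℕ} (π : Equiv.Perm (Fin n)) (p : ℕ) (σ : Equiv.Perm (Fin m)) :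
    MatchesAt π p σ ↔ ∃ h : p + m ≤ n, ∀ i j : Fin m,
      σ i < σ j ↔ π ⟨p + i, by omega⟩ < π ⟨p + j, by omega⟩ := by
  refine exists_congr fun h => ⟨fun he i j => ?_, fun ho => ?_⟩
  · have h1 : std (window π p m h) i < std (window π p m h) j ↔ (σ i : ℕ) < σ j := by rw [he]
    rw [Fin.lt_def, ← h1, std_lt_std_iff]
    rfl
  · funext i
    have h1 : (univ.filter fun j : Fin m => window π p m h j < window π p m h i) =
        (Iio (σ i)).map σ⁻¹.toEmbedding := by
      ext j
      simp only [mem_filter, mem_univ, true_and, mem_map_equiv, mem_Iio]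
      exact (ho j i).symm
    rw [std, h1, card_map, Fin.card_Iio]

/-- The order on the positions of a word for which `stdPerm` is the rank function: compare the
letters, and break ties from left to right. -/
def WordLt {n : ℕ} (w : Fin n → ℕ) (i j : Fin n) : Prop :=
  w i < w j ∨ w i = w j ∧ i < j

theorem stdPerm_lt_iff {n : ℕ} (w : Fin n → ℕ) (i j : Fin n) :
    stdPerm w i < stdPerm w j ↔ WordLt w i j := by
  obtain ⟨hm, ht⟩ := Tuple.eq_sort_iff.1 (rfl : Tuple.sort w = Tuple.sort w)
  have hlex : StrictMono fun a => toLex (w (Tuple.sort w a), Tuple.sort w a) := by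
    intro a b hab
    rw [Prod.Lex.toLex_lt_toLex]
    rcases Nat.lt_or_eq_of_le (hm hab.le) with h | h
    · exact Or.inl h
    · exact Or.inr ⟨h, ht _ _ hab h⟩
  rw [stdPerm, ← hlex.lt_iff_lt, Prod.Lex.toLex_lt_toLex]
  simp [WordLt]

theorem mem_occurrences {Γ : Set AllPerms} {n : ℕ} {π : Equiv.Perm (Fin n)} {o : ℕ × AllPerms} :
    o ∈ occurrences Γ π ↔ o.2 ∈ Γ ∧ MatchesAt π o.1 o.2.2 := by
  simp [occurrences, occSet]

theorem add_le_of_mem_occurrences {Γ : Set AllPerms} {n : ℕ} {π : Equiv.Perm (Fin n)}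
    {o : ℕ × AllPerms} (h : o ∈ occurrences Γ π) : o.1 + o.2.1 ≤ n :=
  (mem_occurrences.1 h).2.1

theorem occurrences_eq_empty {Γ : Set AllPerms} (hΓ : ∀ σ ∈ Γ, 2 ≤ σ.1) {n : ℕ} (hn : n < 2)
    (π : Equiv.Perm (Fin n)) : occurrences Γ π = ∅ :=
  eq_empty_of_forall_notMem fun o ho => by
    have h1 := add_le_of_mem_occurrences ho
    have h2 := hΓ _ (mem_occurrences.1 ho).1
    omega

theorem matchesAt_stdPerm_iff {n m : ℕ} (w : Fin n → ℕ) (p : ℕ) (σ : Equiv.Perm (Fin m)) :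
    MatchesAt (stdPerm w) p σ ↔ ∃ h : p + m ≤ n, ∀ i j : Fin m,
      σ i < σ j ↔ WordLt w ⟨p + i, by omega⟩ ⟨p + j, by omega⟩ := by
  simp only [matchesAt_iff, stdPerm_lt_iff]

section Factor

variable {n a c : ℕ} {w : Fin n → ℕ} {u : Fin a → ℕ} (h : c + a ≤ n)
  (hu : ∀ i : Fin a, u i = w ⟨c + i, by omega⟩)

include hu

theorem wordLt_factor_iff (i j : Fin a) :
    WordLt u i j ↔ WordLt w ⟨c + i, by omega⟩ ⟨c + j, by omega⟩ := by
  simp [WordLt, hu]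

theorem matchesAt_stdPerm_factor : MatchesAt (stdPerm w) c (stdPerm u) := by
  rw [matchesAt_stdPerm_iff]
  exact ⟨h, fun i j => by rw [stdPerm_lt_iff, wordLt_factor_iff h hu]⟩

/-- The occurrences inside a factor `u` of a word depend on `u` only. -/
theorem mem_occurrences_factor_iff {Γ : Set AllPerms} {o : ℕ × AllPerms}
    (ho : o.1 + o.2.1 ≤ a) :
    (c + o.1, o.2) ∈ occurrences Γ (stdPerm w) ↔ o ∈ occurrences Γ (stdPerm u) := by
  rw [mem_occurrences, mem_occurrences, matchesAt_stdPerm_iff, matchesAt_stdPerm_iff]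
  refine and_congr_right fun _ => ⟨fun ⟨h1, h2⟩ => ⟨ho, fun i j => ?_⟩,
    fun ⟨h1, h2⟩ => ⟨by simp only; omega, fun i j => ?_⟩⟩
  · rw [h2, wordLt_factor_iff h hu]
    simp only [add_assoc]
  · rw [h2, wordLt_factor_iff h hu]
    simp only [add_assoc]

end Factor

/-! ### Splitting marked permutations -/

/-- No mark in `T` straddles the boundary between the first `a` positions and the others. -/
def IsSplit (T : Finset (ℕ × AllPerms)) (a : ℕ) : Prop :=
  ∀ o ∈ T, o.1 + o.2.1 ≤ a ∨ a ≤ o.1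

/-- The marks within the first `a` positions. -/
def leftMarks (a : ℕ) (T : Finset (ℕ × AllPerms)) : Finset (ℕ × AllPerms) :=
  T.filter fun o => o.1 + o.2.1 ≤ a

/-- The marks starting after the first `a` positions, moved `a` positions to the left. -/
def rightMarks (a : ℕ) (T : Finset (ℕ × AllPerms)) : Finset (ℕ × AllPerms) :=
  (T.filter fun o => a ≤ o.1).image fun o => (o.1 - a, o.2)

/-- The marks in a concatenation, as in `IsConcat`. -/
def concatMarks (a : ℕ) (T₁ T₂ : Finset (ℕ × AllPerms)) : Finset (ℕ × AllPerms) :=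
  T₁ ∪ T₂.image fun o => (a + o.1, o.2)

theorem mem_rightMarks {a : ℕ} {T : Finset (ℕ × AllPerms)} {o : ℕ × AllPerms} :
    o ∈ rightMarks a T ↔ (a + o.1, o.2) ∈ T := by
  simp only [rightMarks, mem_image, mem_filter]
  constructor
  · rintro ⟨o', ⟨h1, h2⟩, rfl⟩
    simpa [Nat.add_sub_cancel' h2] using h1
  · intro h
    exact ⟨_, ⟨h, Nat.le_add_right _ _⟩, by simp⟩

theorem mem_concatMarks {a : ℕ} {T₁ T₂ : Finset (ℕ × AllPerms)} {o : ℕ × AllPerms} :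
    o ∈ concatMarks a T₁ T₂ ↔ o ∈ T₁ ∨ a ≤ o.1 ∧ (o.1 - a, o.2) ∈ T₂ := by
  simp only [concatMarks, mem_union, mem_image]
  refine or_congr_right ⟨?_, fun h => ⟨_, h.2, ?_⟩⟩
  · rintro ⟨o', h, rfl⟩
    simpa using h
  · simp [Nat.add_sub_cancel' h.1]

theorem concatMarks_left_right {a : ℕ} {T : Finset (ℕ × AllPerms)} (h : IsSplit T a) :
    concatMarks a (leftMarks a T) (rightMarks a T) = T := by
  ext o
  rw [mem_concatMarks, mem_rightMarks, leftMarks, mem_filter]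
  constructor
  · rintro (h1 | h1)
    · exact h1.1
    · simpa [Nat.add_sub_cancel' h1.1] using h1.2
  · intro ho
    rcases h o ho with h1 | h1
    · exact Or.inl ⟨ho, h1⟩
    · exact Or.inr ⟨h1, by simpa [Nat.add_sub_cancel' h1] using ho⟩

section Concat

variable {Γ : Set AllPerms} {a b : ℕ} {α : Equiv.Perm (Fin a)} {β : Equiv.Perm (Fin b)}
  {T₁ T₂ : Finset (ℕ × AllPerms)}

theorem isSplit_concatMarks (h₁ : T₁ ⊆ occurrences Γ α) : IsSplit (concatMarks a T₁ T₂) a := by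
  intro o ho
  rcases mem_concatMarks.1 ho with h | h
  · exact Or.inl (add_le_of_mem_occurrences (h₁ h))
  · exact Or.inr h.1

/-- Up to the first boundary, the boundaries of a concatenation that can be cut are those of its
left part. -/
theorem isSplit_concatMarks_iff (c : ℕ) (hc : c ≤ a) :
    IsSplit (concatMarks a T₁ T₂) c ↔ IsSplit T₁ c := by
  constructor
  · intro h o ho
    exact h o (mem_concatMarks.2 (Or.inl ho))
  · intro h o ho
    rcases mem_concatMarks.1 ho with h1 | h1
    · exact h o h1
    · exact Or.inr (hc.trans h1.1)

variable (hΓ : ∀ σ ∈ Γ, 2 ≤ σ.1)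

include hΓ in
theorem lt_of_mem_of_subset_occurrences (h₁ : T₁ ⊆ occurrences Γ α) {o : ℕ × AllPerms}
    (ho : o ∈ T₁) : o.1 < a := by
  have h2 := add_le_of_mem_occurrences (h₁ ho)
  have h3 := hΓ _ (mem_occurrences.1 (h₁ ho)).1
  omega

include hΓ in
theorem rightMarks_concatMarks (h₁ : T₁ ⊆ occurrences Γ α) :
    rightMarks a (concatMarks a T₁ T₂) = T₂ := by
  ext o
  rw [mem_rightMarks, mem_concatMarks]
  constructor
  · rintro (h | h)
    · have := lt_of_mem_of_subset_occurrences hΓ h₁ h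
      simp only at this
      omega
    · simpa using h.2
  · intro h
    exact Or.inr (by simpa using h)

include hΓ in
theorem leftMarks_concatMarks (h₁ : T₁ ⊆ occurrences Γ α) (h₂ : T₂ ⊆ occurrences Γ β) :
    leftMarks a (concatMarks a T₁ T₂) = T₁ := by
  ext o
  rw [leftMarks, mem_filter, mem_concatMarks]
  constructor
  · rintro ⟨h | h, h'⟩
    · exact h
    · have h3 := hΓ _ (mem_occurrences.1 (h₂ h.2)).1
      simp only at h3
      omega
  · intro h
    exact ⟨Or.inl h, add_le_of_mem_occurrences (h₁ h)⟩

include hΓ in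
theorem card_concatMarks (h₁ : T₁ ⊆ occurrences Γ α) :
    #(concatMarks a T₁ T₂) = #T₁ + #T₂ := by
  rw [concatMarks, card_union_of_disjoint, card_image_of_injective]
  · rintro ⟨p, σ⟩ ⟨p', σ'⟩ h
    simpa using h
  · rw [disjoint_left]
    intro o ho h
    obtain ⟨o', -, rfl⟩ := mem_image.1 h
    have := lt_of_mem_of_subset_occurrences hΓ h₁ ho
    simp only at this
    omega

end Concat

section Append

variable {Γ : Set AllPerms} {a b : ℕ} (u : Fin a → ℕ) (v : Fin b → ℕ)

theorem matchesAt_append_left : MatchesAt (stdPerm (Fin.append u v)) 0 (stdPerm u) := by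
  refine matchesAt_stdPerm_factor (by omega) fun i => ?_
  have : (⟨0 + i, by omega⟩ : Fin (a + b)) = Fin.castAdd b i := Fin.ext (by simp)
  rw [this, Fin.append_left]

theorem matchesAt_append_right : MatchesAt (stdPerm (Fin.append u v)) a (stdPerm v) :=
  matchesAt_stdPerm_factor le_rfl fun i => (Fin.append_right u v i).symm

variable {u v}

theorem mem_occurrences_append_left {o : ℕ × AllPerms} (ho : o.1 + o.2.1 ≤ a) :
    o ∈ occurrences Γ (stdPerm (Fin.append u v)) ↔ o ∈ occurrences Γ (stdPerm u) := by
  have := mem_occurrences_factor_iff (c := 0) (w := Fin.append u v) (u := u) (Γ := Γ) (by omega)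
    (fun i => by
      have : (⟨0 + i, by omega⟩ : Fin (a + b)) = Fin.castAdd b i := Fin.ext (by simp)
      rw [this, Fin.append_left]) ho
  simpa using this

theorem mem_occurrences_append_right {o : ℕ × AllPerms} :
    (a + o.1, o.2) ∈ occurrences Γ (stdPerm (Fin.append u v)) ↔
      o ∈ occurrences Γ (stdPerm v) := by
  by_cases ho : o.1 + o.2.1 ≤ b
  · exact mem_occurrences_factor_iff le_rfl (fun i => (Fin.append_right u v i).symm) ho
  · refine iff_of_false (fun h => ho ?_) fun h => ho (add_le_of_mem_occurrences h)
    have := add_le_of_mem_occurrences h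
    simp only at this
    omega

theorem leftMarks_subset {T : Finset (ℕ × AllPerms)}
    (hT : T ⊆ occurrences Γ (stdPerm (Fin.append u v))) :
    leftMarks a T ⊆ occurrences Γ (stdPerm u) := fun o ho => by
  obtain ⟨h1, h2⟩ := mem_filter.1 ho
  exact (mem_occurrences_append_left h2).1 (hT h1)

theorem rightMarks_subset {T : Finset (ℕ × AllPerms)}
    (hT : T ⊆ occurrences Γ (stdPerm (Fin.append u v))) :
    rightMarks a T ⊆ occurrences Γ (stdPerm v) := fun _ ho =>
  mem_occurrences_append_right.1 (hT (mem_rightMarks.1 ho))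

theorem concatMarks_subset {T₁ T₂ : Finset (ℕ × AllPerms)}
    (h₁ : T₁ ⊆ occurrences Γ (stdPerm u)) (h₂ : T₂ ⊆ occurrences Γ (stdPerm v)) :
    concatMarks a T₁ T₂ ⊆ occurrences Γ (stdPerm (Fin.append u v)) := by
  intro o ho
  rcases mem_concatMarks.1 ho with h | h
  · exact (mem_occurrences_append_left (add_le_of_mem_occurrences (h₁ h))).2 (h₁ h)
  · have := mem_occurrences_append_right (u := u).2 (h₂ h.2)
    simpa [Nat.add_sub_cancel' h.1] using this

end Append

/-- A marked permutation is a cluster if and only if each of its inner boundaries is straddled by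
a mark. -/
theorem isCluster_stdPerm_iff {Γ : Set AllPerms} {n : ℕ} (w : Fin n → ℕ)
    (T : Finset (ℕ × AllPerms)) :
    IsCluster Γ (stdPerm w) T ↔
      T ⊆ occurrences Γ (stdPerm w) ∧ ∀ c, 0 < c → c < n → ¬ IsSplit T c := by
  refine and_congr_right fun hT => ⟨fun h c hc hcn hs => h ?_, ?_⟩
  · obtain ⟨b, rfl⟩ := Nat.exists_eq_add_of_lt hcn
    obtain ⟨⟨u, v⟩, rfl⟩ := (Fin.appendEquiv (α := ℕ) c (b + 1)).surjective w
    exact ⟨c, b + 1, stdPerm u, stdPerm v, leftMarks c T, rightMarks c T, hc, b.succ_pos,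
      leftMarks_subset hT, rightMarks_subset hT, rfl, matchesAt_append_left u v,
      matchesAt_append_right u v, (concatMarks_left_right hs).symm⟩
  · rintro h ⟨a, b, α, β, T₁, T₂, ha, hb, h₁, h₂, hab, -, -, rfl⟩
    exact h a ha (by omega) (isSplit_concatMarks (Γ := Γ) (α := α) h₁)

/-- The length of the first cluster of a marked permutation with marks `T`: the smallest positive
number of initial positions that can be split off (`0` if there is none). -/
noncomputable def firstSplit (T : Finset (ℕ × AllPerms)) : ℕ :=
  sInf {a | 0 < a ∧ IsSplit T a}

theorem firstSplit_eq_iff {T : Finset (ℕ × AllPerms)} {a : ℕ} (ha : 0 < a) :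
    firstSplit T = a ↔ IsSplit T a ∧ ∀ c, 0 < c → c < a → ¬ IsSplit T c := by
  constructor
  · rintro rfl
    exact ⟨(Nat.sInf_mem (Nat.nonempty_of_pos_sInf ha)).2,
      fun c hc hlt hs => Nat.notMem_of_lt_sInf hlt ⟨hc, hs⟩⟩
  · rintro ⟨h1, h2⟩
    refine le_antisymm (Nat.sInf_le ⟨ha, h1⟩) (le_csInf ⟨a, ha, h1⟩ ?_)
    rintro c ⟨hc, hs⟩
    by_contra hlt
    exact h2 c hc (not_le.1 hlt) hs

theorem firstSplit_mem_Ico {Γ : Set AllPerms} {n : ℕ} (hn : 0 < n) {π : Equiv.Perm (Fin n)}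
    {T : Finset (ℕ × AllPerms)} (hT : T ⊆ occurrences Γ π) : firstSplit T ∈ Ico 1 (n + 1) := by
  have hmem : n ∈ {a | 0 < a ∧ IsSplit T a} :=
    ⟨hn, fun o ho => Or.inl (add_le_of_mem_occurrences (hT ho))⟩
  rw [mem_Ico]
  exact ⟨(Nat.sInf_mem ⟨n, hmem⟩).1, Nat.lt_succ_of_le (Nat.sInf_le hmem)⟩

theorem mem_clusters {Γ : Set AllPerms} {n : ℕ} {π : Equiv.Perm (Fin n)}
    {T : Finset (ℕ × AllPerms)} : T ∈ clusters Γ π ↔ IsCluster Γ π T := by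
  simp only [clusters, mem_filter, mem_powerset, and_iff_right_iff_imp]
  exact fun h => h.1

section Recursion

variable {K : Type*} [CommRing K] {Γ : Set AllPerms}

/-- Splitting off the first cluster: a marked word whose first cluster has length `a` consists of
a cluster on the first `a` letters and an arbitrary marking of the others. -/
theorem sum_firstSplit_eq_mul (hΓ : ∀ σ ∈ Γ, 2 ≤ σ.1) (y : K) {a b : ℕ} (ha : 0 < a)
    (u : Fin a → ℕ) (v : Fin b → ℕ) :
    ∑ T ∈ (occurrences Γ (stdPerm (Fin.append u v))).powerset with firstSplit T = a, y ^ #T =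
      (∑ T ∈ clusters Γ (stdPerm u), y ^ #T) *
        ∑ T ∈ (occurrences Γ (stdPerm v)).powerset, y ^ #T := by
  rw [sum_mul_sum, ← sum_product']
  symm
  refine sum_bij' (fun x _ => concatMarks a x.1 x.2)
    (fun T _ => (leftMarks a T, rightMarks a T)) ?_ ?_ ?_ ?_ ?_
  · rintro ⟨T₁, T₂⟩ h
    rw [mem_product, mem_clusters, isCluster_stdPerm_iff, mem_powerset] at h
    obtain ⟨⟨h₁, hc⟩, h₂⟩ := h
    rw [mem_filter, mem_powerset, firstSplit_eq_iff ha]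
    exact ⟨concatMarks_subset h₁ h₂, isSplit_concatMarks h₁,
      fun c h0 hlt => by rw [isSplit_concatMarks_iff c hlt.le]; exact hc c h0 hlt⟩
  · intro T h
    rw [mem_filter, mem_powerset, firstSplit_eq_iff ha] at h
    obtain ⟨hT, hs, hc⟩ := h
    rw [mem_product, mem_clusters, isCluster_stdPerm_iff, mem_powerset]
    refine ⟨⟨leftMarks_subset hT, fun c h0 hlt => ?_⟩, rightMarks_subset hT⟩
    rw [← isSplit_concatMarks_iff (T₂ := rightMarks a T) c hlt.le, concatMarks_left_right hs]
    exact hc c h0 hlt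
  · rintro ⟨T₁, T₂⟩ h
    rw [mem_product, mem_clusters, isCluster_stdPerm_iff, mem_powerset] at h
    obtain ⟨⟨h₁, hc⟩, h₂⟩ := h
    simp only
    rw [leftMarks_concatMarks hΓ h₁ h₂, rightMarks_concatMarks hΓ h₁]
  · intro T h
    rw [mem_filter, firstSplit_eq_iff ha] at h
    exact concatMarks_left_right h.2.1
  · rintro ⟨T₁, T₂⟩ h
    rw [mem_product, mem_clusters] at h
    rw [card_concatMarks hΓ h.1.1, pow_add]

theorem sum_words_add (a b k : ℕ) (f : (Fin (a + b) → ℕ) → K) :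
    ∑ w ∈ words (a + b) k, f w = ∑ u ∈ words a k, ∑ v ∈ words b k, f (Fin.append u v) := by
  rw [← sum_product']
  symm
  refine sum_equiv (Fin.appendEquiv a b) (fun x => ?_) (fun x _ => rfl)
  simp only [mem_product, mem_words]
  constructor
  · rintro ⟨h1, h2⟩ i
    induction i using Fin.addCases with
    | left i => simpa using h1 i
    | right i => simpa using h2 i
  · intro h
    exact ⟨fun i => by simpa using h (Fin.castAdd b i),
      fun i => by simpa using h (Fin.natAdd a i)⟩

variable (Γ) in
/-- The generating function of the marked words of length `n` with letters below `k`; `q` records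
the letter sum and `y` the number of marks. -/
noncomputable def markedSum (y q : K) (k n : ℕ) : K :=
  ∑ w ∈ words n k, (∑ T ∈ (occurrences Γ (stdPerm w)).powerset, y ^ #T) * q ^ ∑ i, w i

variable (Γ) in
/-- The generating function of the clusters on words of length `n` with letters below `k`. -/
noncomputable def clusterSum (y q : K) (k n : ℕ) : K :=
  ∑ w ∈ words n k, (∑ T ∈ clusters Γ (stdPerm w), y ^ #T) * q ^ ∑ i, w i

theorem markedSum_succ (hΓ : ∀ σ ∈ Γ, 2 ≤ σ.1) (y q : K) (k n : ℕ) :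
    markedSum Γ y q k (n + 1) =
      ∑ i ∈ range (n + 1), clusterSum Γ y q k (i + 1) * markedSum Γ y q k (n - i) := by
  have h1 : markedSum Γ y q k (n + 1) = ∑ a ∈ Ico 1 (n + 1 + 1), ∑ w ∈ words (n + 1) k,
      (∑ T ∈ (occurrences Γ (stdPerm w)).powerset with firstSplit T = a, y ^ #T) *
        q ^ ∑ i, w i := by
    rw [sum_comm]
    refine sum_congr rfl fun w _ => ?_
    rw [← sum_mul, sum_fiberwise_of_maps_to]
    exact fun T hT => firstSplit_mem_Ico n.succ_pos (mem_powerset.1 hT)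
  rw [h1, sum_Ico_eq_sum_range]
  refine sum_congr (by simp) fun i hi => ?_
  obtain ⟨b, rfl⟩ : ∃ b, n = i + b := ⟨n - i, by have := mem_range.1 hi; omega⟩
  rw [Nat.add_sub_cancel_left, add_right_comm i b 1, add_comm 1 i, sum_words_add, clusterSum,
    markedSum, sum_mul_sum]
  refine sum_congr rfl fun u _ => sum_congr rfl fun v _ => ?_
  rw [sum_firstSplit_eq_mul hΓ y i.succ_pos, Fin.sum_univ_add]
  simp only [Fin.append_left, Fin.append_right, pow_add]
  ring

end Recursion

/-! ### Formal sums graded by `x` -/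

/-- The sum of a sequence of series in `s, q, x`, taken coefficient by coefficient: the version of
`formalSum` for a single power of `t`. -/
noncomputable def coeffSum (f : ℕ → SeriesSQX) : SeriesSQX :=
  (fun d => ∑ᶠ n, MvPowerSeries.coeff d (f n) : (Fin 3 →₀ ℕ) → ℚ)

theorem coeff_formalSum (f : ℕ → Series) (k : ℕ) :
    PowerSeries.coeff k (formalSum f) = coeffSum fun n => PowerSeries.coeff k (f n) := by
  exact PowerSeries.coeff_mk k (fun k => coeffSum fun n => PowerSeries.coeff k (f n))

theorem coeff_eq_zero_of_X_pow_dvd {f : SeriesSQX} {n : ℕ} (h : MvPowerSeries.X 2 ^ n ∣ f)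
    {d : Fin 3 →₀ ℕ} (hd : d 2 < n) : MvPowerSeries.coeff d f = 0 :=
  MvPowerSeries.X_pow_dvd_iff.1 h d hd

theorem formallySummable_of_X_pow_dvd {f : ℕ → Series}
    (h : ∀ k n, MvPowerSeries.X 2 ^ n ∣ PowerSeries.coeff k (f n)) : FormallySummable f := by
  intro k d
  refine (Set.finite_Iic (d 2)).subset fun n hn => ?_
  by_contra hlt
  exact hn (coeff_eq_zero_of_X_pow_dvd (h k n) (not_le.1 hlt))

theorem X_pow_dvd_coeffSum_sub {f : ℕ → SeriesSQX} (h : ∀ n, MvPowerSeries.X 2 ^ n ∣ f n)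
    (N : ℕ) : MvPowerSeries.X 2 ^ N ∣ coeffSum f - ∑ n ∈ range N, f n := by
  rw [MvPowerSeries.X_pow_dvd_iff]
  intro d hd
  have h1 : MvPowerSeries.coeff d (coeffSum f) = ∑ n ∈ range N, MvPowerSeries.coeff d (f n) := by
    refine finsum_eq_sum_of_support_subset _ fun n hn => ?_
    simp only [coe_range, Set.mem_Iio]
    by_contra hle
    exact hn (coeff_eq_zero_of_X_pow_dvd (h n) (hd.trans_le (not_lt.1 hle)))
  rw [map_sub, map_sum, h1, sub_self]

theorem eq_of_forall_X_pow_dvd_sub {f g : SeriesSQX}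
    (h : ∀ N, (MvPowerSeries.X 2 : SeriesSQX) ^ N ∣ f - g) : f = g := by
  ext d
  have := coeff_eq_zero_of_X_pow_dvd (h (d 2 + 1)) (Nat.lt_succ_self (d 2))
  rwa [map_sub, sub_eq_zero] at this

/-- The formal sum of a sequence starting with `f 0 = 1` that satisfies the renewal equation with
kernel `r` solves `F = 1 + G F`, where `G` is the formal sum of `r`. -/
theorem coeffSum_eq_one_add_mul {a r : ℕ → SeriesSQX} (h0 : a 0 = 1)
    (hs : ∀ n, a (n + 1) = ∑ i ∈ range (n + 1), r i * a (n - i)) :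
    coeffSum (fun n => a n * MvPowerSeries.X 2 ^ n) =
      1 + coeffSum (fun n => r n * MvPowerSeries.X 2 ^ (n + 1)) *
        coeffSum (fun n => a n * MvPowerSeries.X 2 ^ n) := by
  set x : SeriesSQX := MvPowerSeries.X 2 with hx
  have hF := X_pow_dvd_coeffSum_sub (f := fun n => a n * x ^ n) fun n => Dvd.intro_left _ rfl
  have hG := X_pow_dvd_coeffSum_sub (f := fun n => r n * x ^ (n + 1)) fun n =>
    (pow_dvd_pow x n.le_succ).mul_left _
  set F := coeffSum fun n => a n * x ^ n
  set G := coeffSum fun n => r n * x ^ (n + 1)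
  refine eq_of_forall_X_pow_dvd_sub fun N => ?_
  have hpart : ∑ n ∈ range (N + 1), a n * x ^ n =
      1 + ∑ i ∈ range N, r i * x ^ (i + 1) * ∑ j ∈ range (N - i), a j * x ^ j := by
    rw [sum_range_succ', h0, pow_zero, mul_one, add_comm]
    congr 1
    simp only [mul_sum]
    rw [← sum_range_diag_flip N fun i j => r i * x ^ (i + 1) * (a j * x ^ j)]
    refine sum_congr rfl fun n _ => ?_
    rw [hs, sum_mul]
    refine sum_congr rfl fun i hi => ?_
    have hi' : n + 1 = i + 1 + (n - i) := by have := mem_range.1 hi; omega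
    rw [hi', pow_add]
    ring
  -- modulo `x ^ N`, the truncated inner sum in `hpart` may be replaced by `F`, because it carries
  -- the factor `x ^ (i + 1)`
  have hdiff : F - (1 + G * F) = (F - ∑ n ∈ range (N + 1), a n * x ^ n) -
      (G - ∑ i ∈ range N, r i * x ^ (i + 1)) * F -
      ∑ i ∈ range N, r i * x ^ (i + 1) * (F - ∑ j ∈ range (N - i), a j * x ^ j) := by
    simp only [mul_sub, sum_sub_distrib, ← sum_mul]
    rw [hpart]
    ring
  rw [hdiff]
  refine dvd_sub (dvd_sub ((pow_dvd_pow x N.le_succ).trans (hF _)) ((hG N).mul_right _))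
    (dvd_sum fun i hi => ?_)
  have hi' : N = i + (N - i) := by have := mem_range.1 hi; omega
  conv_lhs => rw [hi', pow_add]
  exact mul_dvd_mul ((pow_dvd_pow x i.le_succ).mul_left _) (hF _)

/-- The equation `F = 1 + G F` has the geometric series as its only solution. -/
theorem eq_coeffSum_pow {F G : SeriesSQX} (hG : MvPowerSeries.X 2 ∣ G) (h : F = 1 + G * F) :
    F = coeffSum fun n => G ^ n := by
  have hS := X_pow_dvd_coeffSum_sub (f := fun n => G ^ n) fun n => pow_dvd_pow_of_dvd hG n
  have hF : ∀ N, F = ∑ n ∈ range N, G ^ n + G ^ N * F := by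
    intro N
    induction N with
    | zero => simp
    | succ N ih =>
      rw [sum_range_succ]
      calc F = ∑ n ∈ range N, G ^ n + G ^ N * F := ih
        _ = ∑ n ∈ range N, G ^ n + G ^ N * (1 + G * F) := by rw [← h]
        _ = _ := by ring
  refine eq_of_forall_X_pow_dvd_sub fun N => ?_
  have : F - coeffSum (fun n => G ^ n) =
      G ^ N * F - (coeffSum (fun n => G ^ n) - ∑ n ∈ range N, G ^ n) := by
    nth_rewrite 1 [hF N]
    ring
  rw [this]
  exact dvd_sub ((pow_dvd_pow_of_dvd hG N).mul_right _) (hS N)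

/-! ### Coefficients of the two sides -/

theorem coeff_hadamardPow (f : Series) (k n : ℕ) :
    PowerSeries.coeff k (hadamardPow f n) = PowerSeries.coeff k f ^ n := by
  induction n with
  | zero =>
    have h : recip (1 - varT) = PowerSeries.mk 1 := by
      have h1 := PowerSeries.mk_one_mul_one_sub_eq_one SeriesSQX
      have h2 := mul_recip (1 - varT) (by simp [varT])
      calc recip (1 - varT) = (PowerSeries.mk 1 * (1 - PowerSeries.X)) * recip (1 - varT) := by
            rw [h1, one_mul]
        _ = PowerSeries.mk 1 := by
            rw [mul_assoc]
            exact (congrArg _ h2).trans (mul_one _)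
    simp [hadamardPow, h]
  | succ n ih => rw [hadamardPow, hadamard, PowerSeries.coeff_mk, ih, pow_succ]

theorem coeff_mul_varX_pow (f : Series) (k n : ℕ) :
    PowerSeries.coeff k (f * varX ^ n) = PowerSeries.coeff k f * MvPowerSeries.X 2 ^ n := by
  rw [varX, ← map_pow, PowerSeries.coeff_mul_C]

theorem coeff_sum_perm_mul_recip {n : ℕ} (hn : n ≠ 0) (φ : Equiv.Perm (Fin n) → SeriesSQX)
    (k : ℕ) :
    PowerSeries.coeff k ((∑ π : Equiv.Perm (Fin n),
        PowerSeries.C (φ π) * (varT ^ (ides π + 1) * varQ ^ icomaj π)) * recip (qProd n)) =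
      ∑ w ∈ words n k, φ (stdPerm w) * MvPowerSeries.X 1 ^ ∑ i, w i := by
  have hq : (MvPowerSeries.X 1 : SeriesSQX) ≠ 0 := fun h => by
    simpa using congrArg (MvPowerSeries.coeff (Finsupp.single 1 1)) h
  have : IsDomain SeriesSQX := NoZeroDivisors.to_isDomain _
  have h : ∀ π : Equiv.Perm (Fin n), varT ^ (ides π + 1) * varQ ^ icomaj π * recip (qProd n) =
      PowerSeries.mk fun k => ∑ w ∈ words n k with stdPerm w = π,
        (MvPowerSeries.X 1 : SeriesSQX) ^ ∑ i, w i := by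
    intro π
    have h1 := mk_sum_words_stdPerm _ hq hn π
    have h2 := mul_recip _ (constantCoeff_qProd n)
    have h3 : qProdSeries (MvPowerSeries.X 1 : SeriesSQX) n = qProd n := rfl
    rw [varT, varQ, ← h1, h3, mul_assoc, h2, mul_one]
  rw [sum_mul, map_sum, ← sum_fiberwise (words n k) stdPerm]
  refine sum_congr rfl fun π _ => ?_
  rw [mul_assoc, PowerSeries.coeff_C_mul, h, PowerSeries.coeff_mk, mul_sum]
  refine sum_congr rfl fun w hw => ?_
  rw [(mem_filter.1 hw).2]

theorem sum_powerset_sub_one_pow {K : Type*} [CommRing K] (s : K) {α : Type*} (A : Finset α) :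
    ∑ T ∈ A.powerset, (s - 1) ^ #T = s ^ #A := by
  simpa using sum_pow_mul_eq_add_pow (s - 1) 1 A

theorem markedSum_zero {Γ : Set AllPerms} (hΓ : ∀ σ ∈ Γ, 2 ≤ σ.1) {K : Type*} [CommRing K]
    (y q : K) (k : ℕ) : markedSum Γ y q k 0 = 1 := by
  simp [markedSum, occurrences_eq_empty hΓ zero_lt_two, words]

/-- The inclusion–exclusion step: the coefficient of `t ^ k` on the left counts the words over
`{0, …, k - 1}` by occurrences, that is, the marked words with weight `s - 1` for each mark. -/
theorem coeff_polyA_mul_recip {Γ : Set AllPerms} (hΓ : ∀ σ ∈ Γ, 2 ≤ σ.1) (k n : ℕ) :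
    PowerSeries.coeff k (polyA Γ n varS varT varQ * recip (qProd n)) =
      markedSum Γ (MvPowerSeries.X 0 - 1) (MvPowerSeries.X 1) k n := by
  rcases eq_or_ne n 0 with rfl | hn
  · have h1 := coeff_hadamardPow 0 k 0
    have h2 : qProd 0 = 1 - varT := by simp [qProd]
    rw [markedSum_zero hΓ, polyA, if_pos rfl, one_mul, h2]
    simpa [hadamardPow] using h1
  · have h1 : polyA Γ n varS varT varQ = ∑ π : Equiv.Perm (Fin n),
        PowerSeries.C ((MvPowerSeries.X 0 : SeriesSQX) ^ occ Γ π) *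
          (varT ^ (ides π + 1) * varQ ^ icomaj π) := by
      rw [polyA, if_neg hn]
      refine sum_congr rfl fun π _ => ?_
      rw [map_pow, varS, mul_assoc]
    rw [h1, coeff_sum_perm_mul_recip hn, markedSum]
    refine sum_congr rfl fun w _ => ?_
    rw [sum_powerset_sub_one_pow, occ]

theorem coeff_polyR_mul_recip (Γ : Set AllPerms) {n : ℕ} (hn : n ≠ 0) (k : ℕ) :
    PowerSeries.coeff k (polyR Γ n (varS - 1) varT varQ * recip (qProd n)) =
      clusterSum Γ (MvPowerSeries.X 0 - 1) (MvPowerSeries.X 1) k n := by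
  have h1 : polyR Γ n (varS - 1) varT varQ = ∑ π : Equiv.Perm (Fin n),
      PowerSeries.C (∑ c ∈ clusters Γ π, (MvPowerSeries.X 0 - 1 : SeriesSQX) ^ #c) *
        (varT ^ (ides π + 1) * varQ ^ icomaj π) := by
    refine sum_congr rfl fun π _ => ?_
    rw [mul_comm, map_sum]
    simp only [map_pow, map_sub, map_one, varS]
  rw [h1, coeff_sum_perm_mul_recip hn, clusterSum]

/-- As every pattern has length at least `2`, the only cluster of length `1` is the unmarked
letter. -/
theorem polyR_one {Γ : Set AllPerms} (hΓ : ∀ σ ∈ Γ, 2 ≤ σ.1) {K : Type*} [CommRing K]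
    (s t q : K) : polyR Γ 1 s t q = t := by
  have hd : ∀ π : Equiv.Perm (Fin 1), desSet π = ∅ := fun π => by simp [desSet]
  have h : ∀ π : Equiv.Perm (Fin 1), clusters Γ π = {∅} := fun π => by
    have h1 := occurrences_eq_empty hΓ one_lt_two π
    ext T
    rw [mem_clusters, mem_singleton]
    constructor
    · intro hT
      have := hT.1
      rwa [IsMarked, h1, subset_empty] at this
    · rintro rfl
      refine ⟨empty_subset _, ?_⟩
      rintro ⟨a, b, α, β, T₁, T₂, ha, hb, -, -, hab, -⟩
      omega
  simp [polyR, h, ides, icomaj, des, comaj, hd]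

/-- The summands on the right, with the single letter as the cluster of length `1`. -/
theorem coeff_cluster_series {Γ : Set AllPerms} (hΓ : ∀ σ ∈ Γ, 2 ≤ σ.1) (k : ℕ) :
    PowerSeries.coeff k (varT * varX * recip ((1 - varT) * (1 - varT * varQ)) +
        formalSum fun j =>
          polyR Γ (j + 2) (varS - 1) varT varQ * varX ^ (j + 2) * recip (qProd (j + 2))) =
      coeffSum fun n => clusterSum Γ (MvPowerSeries.X 0 - 1) (MvPowerSeries.X 1) k (n + 1) *
        MvPowerSeries.X 2 ^ (n + 1) := by
  set r := clusterSum Γ (MvPowerSeries.X 0 - 1 : SeriesSQX) (MvPowerSeries.X 1) k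
  set x : SeriesSQX := MvPowerSeries.X 2
  have h1 : PowerSeries.coeff k (varT * varX * recip ((1 - varT) * (1 - varT * varQ))) =
      r 1 * x := by
    have hq : (1 - varT) * (1 - varT * varQ) = qProd 1 := by
      simp [qProd, prod_range_succ]
    have := coeff_polyR_mul_recip Γ one_ne_zero k
    rw [polyR_one hΓ] at this
    rw [hq, mul_right_comm, ← pow_one varX, coeff_mul_varX_pow, this, pow_one]
  have h2 : ∀ j, PowerSeries.coeff k
      (polyR Γ (j + 2) (varS - 1) varT varQ * varX ^ (j + 2) * recip (qProd (j + 2))) =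
      r (j + 2) * x ^ (j + 2) := by
    intro j
    rw [mul_right_comm, coeff_mul_varX_pow, coeff_polyR_mul_recip Γ (by omega)]
  rw [map_add, coeff_formalSum, h1]
  simp only [h2]
  refine eq_of_forall_X_pow_dvd_sub fun N => ?_
  have h3 := X_pow_dvd_coeffSum_sub (f := fun j => r (j + 2) * x ^ (j + 2))
    (fun j => (pow_dvd_pow x (by omega)).mul_left _) N
  have h4 := X_pow_dvd_coeffSum_sub (f := fun n => r (n + 1) * x ^ (n + 1))
    (fun n => (pow_dvd_pow x (by omega)).mul_left _) (N + 1)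
  rw [sum_range_succ'] at h4
  convert dvd_sub h3 ((pow_dvd_pow x N.le_succ).trans h4) using 1
  ring

end PermCluster

open PermCluster

theorem theorem3p4 (Γ : Set AllPerms) (hΓ : ∀ σ ∈ Γ, 2 ≤ σ.1) :
    FormallySummable (fun n => polyA Γ n varS varT varQ * recip (qProd n) * varX ^ n) ∧
    FormallySummable
      (fun j => polyR Γ (j + 2) (varS - 1) varT varQ * varX ^ (j + 2) * recip (qProd (j + 2))) ∧
    FormallySummable
      (fun n => hadamardPow
        (varT * varX * recip ((1 - varT) * (1 - varT * varQ)) +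
          formalSum (fun j =>
            polyR Γ (j + 2) (varS - 1) varT varQ * varX ^ (j + 2) * recip (qProd (j + 2)))) n) ∧
    formalSum (fun n => polyA Γ n varS varT varQ * recip (qProd n) * varX ^ n) =
      formalSum (fun n => hadamardPow
        (varT * varX * recip ((1 - varT) * (1 - varT * varQ)) +
          formalSum (fun j =>
            polyR Γ (j + 2) (varS - 1) varT varQ * varX ^ (j + 2) * recip (qProd (j + 2)))) n) := by

  have hsum2 : ∀ k j, MvPowerSeries.X 2 ^ j ∣ PowerSeries.coeff k
      (polyR Γ (j + 2) (varS - 1) varT varQ * varX ^ (j + 2) * recip (qProd (j + 2))) := by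
    intro k j
    rw [mul_right_comm, coeff_mul_varX_pow]
    exact (pow_dvd_pow _ (by omega)).mul_left _
  have hG : ∀ k, MvPowerSeries.X 2 ∣ PowerSeries.coeff k
      (varT * varX * recip ((1 - varT) * (1 - varT * varQ)) +
        formalSum (fun j =>
          polyR Γ (j + 2) (varS - 1) varT varQ * varX ^ (j + 2) * recip (qProd (j + 2)))) := by
    intro k
    rw [coeff_cluster_series hΓ]
    have h := X_pow_dvd_coeffSum_sub (f := fun n =>
      clusterSum Γ (MvPowerSeries.X 0 - 1) (MvPowerSeries.X 1) k (n + 1) *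
        MvPowerSeries.X 2 ^ (n + 1)) (fun n => (pow_dvd_pow _ n.le_succ).mul_left _) 1
    rw [pow_one, sum_range_one, zero_add, pow_one] at h
    exact (dvd_sub_left (Dvd.intro_left _ rfl)).1 h
  refine ⟨formallySummable_of_X_pow_dvd fun k n => ?_, formallySummable_of_X_pow_dvd hsum2,
    formallySummable_of_X_pow_dvd fun k n => ?_, ?_⟩
  · rw [coeff_mul_varX_pow]
    exact Dvd.intro_left _ rfl
  · rw [coeff_hadamardPow]
    exact pow_dvd_pow_of_dvd (hG k) n
  · refine PowerSeries.ext fun k => ?_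
    rw [coeff_formalSum, coeff_formalSum]
    simp only [coeff_mul_varX_pow, coeff_hadamardPow, coeff_polyA_mul_recip hΓ]
    refine eq_coeffSum_pow (hG k) ?_
    rw [coeff_cluster_series hΓ]
    exact coeffSum_eq_one_add_mul (markedSum_zero hΓ _ _ k) (markedSum_succ hΓ _ _ k)
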